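/- For integers $s_1,\dots,s_d$ and $N\ge 0$ put $$H(s_1,\dots,s_d;N)=\sum_{1\le k_1<\cdots<k_d\le N}k_1^{-s_1}\cdots k_d^{-s_d},\qquad S(s_1,\dots,s_d;N)=\sum_{1\le k_1\le\cdots\le k_d\le N}k_1^{-s_1}\cdots k_d^{-s_d}.$$ Let $B_k$ be the Bernoulli numbers, $t/(e^t-1)=\sum_{k\ge 0}B_kt^k/k!$. For rational numbers $a,b$ and a prime $p$, $a\equiv b\pmod p$ means that $a-b=pc$ for a rational number $c$ whose denominator is prime to $p$. **Theorem.** Let $p$ be an odd prime, let $s_1,s_2,s_3$ be positive integers, and let $0\le l,m,n\le p-2$ satisfy $s_1\equiv l$, $s_2\equiv m$, $s_3\equiv n\pmod{p-1}$. Then $H(s_1,s_2,s_3;p-1)\equiv H(l,m,n;p-1)\pmod p$, and $$\begin{aligned} H(0,m,n;p-1)&\equiv H(m-1,n;p-1)-H(m,n;p-1)&\pmod p,\\ H(l,0,n;p-1)&\equiv H(l,n-1;p-1)-H(l,n;p-1)-H(l-1,n;p-1)&\pmod p,\\ H(l,m,0;p-1)&\equiv -H(l,m-1;p-1)-H(l,m;p-1)&\pmod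 p. \end{aligned}$$ Suppose that $l,m,n\ge 1$ and that $w=l+m+n$ is odd. Then $$H(l,m,n;p-1)\equiv I(l,m,n)-I(n,m,l)\pmod p,$$ where, with $w'=w-(p-1)$ if $p<w<2p$ and $w'=w$ otherwise, $$I(l,m,n)=\begin{cases}0&\text{if } w\ge 2p,\text{ or if } l+m<p \text{ and } p<w<2p-1,\\[2pt] \dfrac1{2n}&\text{if } w=p \text{ or } w=2p-1,\\[4pt] (-1)^{n+1}\dbinom{w'}{n}\dfrac{B_{p-w'}}{2w'}&\text{otherwise.}\end{cases}$$ In particular, if $l,m,n$ are positive integers such that $w=l+m+n$ is odd and $p>w$, then $$H(l,m,n;p-1)\equiv -S(l,m,n;p-1)\equiv\left[(-1)^l\binom wl-(-1)^n\binom wn\right]\frac{B_{p-w}}{2w}\pmod p.$$ -/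

import Mathlib

/-- The multiple harmonic sum
`H(s₁, …, s_d; N) = ∑_{1 ≤ k₁ < ⋯ < k_d ≤ N} k₁^{-s₁} ⋯ k_d^{-s_d}`, for integer exponents
(an exponent `-1` can occur in the reduction formulas). It is `0` when `N < d`. -/
def multHarmonicSum {d : ℕ} (s : Fin d → ℤ) (N : ℕ) : ℚ :=
  ∑ k ∈ (Fintype.piFinset fun _ : Fin d => Finset.Icc 1 N).filter
      (fun k => ∀ i j : Fin d, i < j → k i < k j),
    ∏ i, (k i : ℚ) ^ (-(s i))

/-- The non-strict multiple harmonic sum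
`S(s₁, …, s_d; N) = ∑_{1 ≤ k₁ ≤ ⋯ ≤ k_d ≤ N} k₁^{-s₁} ⋯ k_d^{-s_d}`. -/
def multHarmonicSumStar {d : ℕ} (s : Fin d → ℤ) (N : ℕ) : ℚ :=
  ∑ k ∈ (Fintype.piFinset fun _ : Fin d => Finset.Icc 1 N).filter
      (fun k => ∀ i j : Fin d, i ≤ j → k i ≤ k j),
    ∏ i, (k i : ℚ) ^ (-(s i))

/-- Congruence of rational numbers modulo a prime `p`: the difference is `p` times a
rational number whose denominator (in lowest terms) is not divisible by `p`. -/
def RatModEq (p : ℕ) (a b : ℚ) : Prop :=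
  ∃ c : ℚ, ¬ p ∣ c.den ∧ a - b = (p : ℚ) * c

/-- For `w = l + m + n`: `w' = w - (p - 1)` if `p < w < 2p`, and `w' = w` otherwise. -/
def reducedWeight (p w : ℕ) : ℕ :=
  if p < w ∧ w < 2 * p then w - (p - 1) else w

/-- The quantity `I(l, m, n)` (it depends on `p`). The last case is reached, for odd `w`, only
when `w' < p`, so the subtraction `p - w'` in the Bernoulli index is not truncated. -/
def oddTripleI (p l m n : ℕ) : ℚ :=
  if 2 * p ≤ l + m + n ∨ (l + m < p ∧ p < l + m + n ∧ l + m + n < 2 * p - 1) then 0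
  else if l + m + n = p ∨ l + m + n = 2 * p - 1 then 1 / (2 * (n : ℚ))
  else
    (-1) ^ (n + 1) * (Nat.choose (reducedWeight p (l + m + n)) n : ℚ) *
      (bernoulli (p - reducedWeight p (l + m + n)) /
        (2 * (reducedWeight p (l + m + n) : ℚ)))

/-! All sums involve only denominators prime to `p`, so congruences become equalities in `ZMod p`.
There `i ^ (p - 1) = 1` for `i ≠ 0`, so exponents matter only modulo `p - 1`; an exponent `0` is
removed by counting the values of its free index.

For odd weight, two symmetries meet. If the power sums of exponents `a` and `c` vanish, the antipode
relation (`strictSum₃_eq_weakSum₃`) gives `H(a,b,c) = S(c,b,a)`. Splitting `S` along equal indices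
gives `H(c,b,a) + H(c+b,a) + H(c,a+b)` plus a power sum that vanishes because `p - 1` is even. The
reflection `k ↦ p - k` reverses the exponents at the cost of the sign `-1`. Hence `2 H(a,b,c) =
H(b+c,a) - H(a+b,c)`.

For the double sums, Faulhaber's formula turns the inner sum into a polynomial in the outer index,
and orthogonality of power sums leaves at most one Bernoulli term (`strictSum₂_invPow_eq`). Thus
`I(l,m,n)` is `-H(l+m,n)/2` modulo `p`; its cases record how `l + m` reduces modulo `p - 1`. -/

/-- The rational number `q` is `p`-integral with residue `x` modulo `p`. -/
def ReducesTo (p : ℕ) [Fact p.Prime] (q : ℚ) (x : ZMod p) : Prop :=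
  ∃ a b : ℤ, (b : ZMod p) ≠ 0 ∧ q = a / b ∧ x = a / b

/-! ### Residues of `p`-integral rationals -/

namespace ReducesTo

variable {p : ℕ} [Fact p.Prime] {q r : ℚ} {x y : ZMod p}

theorem ratCast_ne_zero {b : ℤ} (hb : (b : ZMod p) ≠ 0) : (b : ℚ) ≠ 0 := by
  rintro h
  apply hb
  have : b = 0 := by exact_mod_cast h
  simp [this]

theorem intCast (a : ℤ) : ReducesTo p a a := ⟨a, 1, by simp, by simp, by simp⟩

theorem natCast (a : ℕ) : ReducesTo p a a := by
  simpa using intCast (p := p) (a : ℤ)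

theorem zero : ReducesTo p 0 0 := by simpa using natCast (p := p) 0

theorem one : ReducesTo p 1 1 := by simpa using natCast (p := p) 1

theorem add (hq : ReducesTo p q x) (hr : ReducesTo p r y) : ReducesTo p (q + r) (x + y) := by
  obtain ⟨a, b, hb, rfl, rfl⟩ := hq
  obtain ⟨c, d, hd, rfl, rfl⟩ := hr
  have hb' := ratCast_ne_zero hb
  have hd' := ratCast_ne_zero hd
  refine ⟨a * d + b * c, b * d, by push_cast; exact mul_ne_zero hb hd, ?_, ?_⟩
  · push_cast; exact div_add_div _ _ hb' hd'
  · push_cast; exact div_add_div _ _ hb hd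

theorem mul (hq : ReducesTo p q x) (hr : ReducesTo p r y) : ReducesTo p (q * r) (x * y) := by
  obtain ⟨a, b, hb, rfl, rfl⟩ := hq
  obtain ⟨c, d, hd, rfl, rfl⟩ := hr
  refine ⟨a * c, b * d, by push_cast; exact mul_ne_zero hb hd, ?_, ?_⟩
  · push_cast; exact div_mul_div_comm _ _ _ _
  · push_cast; exact div_mul_div_comm _ _ _ _

theorem neg (hq : ReducesTo p q x) : ReducesTo p (-q) (-x) := by
  simpa using (intCast (p := p) (-1)).mul hq

theorem sub (hq : ReducesTo p q x) (hr : ReducesTo p r y) : ReducesTo p (q - r) (x - y) := by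
  simpa [sub_eq_add_neg] using hq.add hr.neg

theorem inv (hq : ReducesTo p q x) (hx : x ≠ 0) : ReducesTo p q⁻¹ x⁻¹ := by
  obtain ⟨a, b, hb, rfl, rfl⟩ := hq
  exact ⟨b, a, fun h => hx (by simp [h]), by simp, by simp⟩

theorem div (hq : ReducesTo p q x) (hr : ReducesTo p r y) (hy : y ≠ 0) :
    ReducesTo p (q / r) (x / y) := by
  simpa [div_eq_mul_inv] using hq.mul (hr.inv hy)

theorem pow (hq : ReducesTo p q x) (n : ℕ) : ReducesTo p (q ^ n) (x ^ n) := by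
  induction n with
  | zero => simpa using one
  | succ n ih => simpa [pow_succ] using ih.mul hq

theorem zpow (hq : ReducesTo p q x) (hx : x ≠ 0) (n : ℤ) : ReducesTo p (q ^ n) (x ^ n) := by
  cases n with
  | ofNat n => simpa using hq.pow n
  | negSucc n => simpa [zpow_negSucc] using (hq.pow (n + 1)).inv (pow_ne_zero _ hx)

theorem sum {ι : Type*} (s : Finset ι) (f : ι → ℚ) (g : ι → ZMod p)
    (h : ∀ i ∈ s, ReducesTo p (f i) (g i)) : ReducesTo p (∑ i ∈ s, f i) (∑ i ∈ s, g i) := by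
  classical
  induction s using Finset.induction_on with
  | empty => simpa using zero
  | insert i s hi ih =>
    rw [Finset.sum_insert hi, Finset.sum_insert hi]
    exact (h i (by simp)).add (ih fun j hj => h j (by simp [hj]))

theorem unique (hq : ReducesTo p q x) (hq' : ReducesTo p q y) : x = y := by
  obtain ⟨a, b, hb, rfl, rfl⟩ := hq
  obtain ⟨c, d, hd, h, rfl⟩ := hq'
  rw [div_eq_div_iff (ratCast_ne_zero hb) (ratCast_ne_zero hd)] at h
  rw [div_eq_div_iff hb hd]
  exact_mod_cast congrArg (Int.cast : ℤ → ZMod p) (by exact_mod_cast h : a * d = c * b)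

theorem ratModEq (hq : ReducesTo p q x) (hr : ReducesTo p r x) : RatModEq p q r := by
  obtain ⟨a, b, hb, rfl, rfl⟩ := hq
  obtain ⟨c, d, hd, rfl, h⟩ := hr
  have hb' := ratCast_ne_zero hb
  have hd' := ratCast_ne_zero hd
  rw [div_eq_div_iff hb hd] at h
  have h' : ((a * d - c * b : ℤ) : ZMod p) = 0 := by push_cast; rw [h, sub_self]
  obtain ⟨t, ht⟩ := (ZMod.intCast_zmod_eq_zero_iff_dvd _ p).1 h'
  -- Since `a/b - c/d = (ad - bc)/(bd)` and `ad - bc = pt`, the quotient by `p` is `t/(bd)`, with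
  -- denominator dividing `bd`.
  refine ⟨(t : ℚ) / ((b * d : ℤ) : ℚ), fun hdvd => ?_, ?_⟩
  · have h1 : (((t : ℚ) / ((b * d : ℤ) : ℚ)).den : ℤ) ∣ b * d := by
      rw [← Rat.divInt_eq_div]
      exact Rat.den_dvd _ _
    have h2 : ((b * d : ℤ) : ZMod p) = 0 :=
      (ZMod.intCast_zmod_eq_zero_iff_dvd _ p).2 ((Int.natCast_dvd_natCast.2 hdvd).trans h1)
    push_cast at h2
    exact mul_ne_zero hb hd h2
  · have ht' : (a * d - c * b : ℚ) = p * t := by exact_mod_cast ht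
    push_cast
    rw [div_sub_div _ _ hb' hd', mul_comm (b : ℚ) c, ht', mul_div_assoc]

end ReducesTo

/-! ### Bernoulli numbers and Faulhaber's formula modulo `p` -/

theorem natCast_zmod_ne_zero {p i : ℕ} (h0 : 0 < i) (hi : i < p) : (i : ZMod p) ≠ 0 := by
  rw [Ne, ZMod.natCast_eq_zero_iff]
  exact Nat.not_dvd_of_pos_of_lt h0 hi

/-- The recursion for `B_k` divides only by integers from `2` to `k + 1`, all units when `k + 1 <
p`. This elementary case of von Staudt–Clausen suffices. -/
theorem bernoulli_reducesTo (p : ℕ) [Fact p.Prime] :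
    ∃ β : ℕ → ZMod p, ∀ k, k + 1 < p → ReducesTo p (bernoulli k) (β k) := by
  have h : ∀ k, k + 1 < p → ∃ x : ZMod p, ReducesTo p (bernoulli' k) x := by
    intro k
    induction k using Nat.strong_induction_on with
    | _ k ih =>
      intro hk
      have : ∃ y : ℕ → ZMod p, ∀ i ∈ Finset.range k, ReducesTo p
          ((k.choose i : ℚ) / (k - i + 1) * bernoulli' i) (y i) := by
        choose! β hβ using ih
        refine ⟨fun i => (k.choose i : ZMod p) / ((k - i + 1 : ℕ) : ZMod p) * β i,
          fun i hi => ?_⟩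
        rw [Finset.mem_range] at hi
        have e : (k : ℚ) - i + 1 = ((k - i + 1 : ℕ) : ℚ) := by
          push_cast [Nat.cast_sub hi.le]; rfl
        rw [e]
        exact ((ReducesTo.natCast _).div (ReducesTo.natCast _)
          (natCast_zmod_ne_zero (by omega) (by omega))).mul (hβ i hi (by omega))
      obtain ⟨y, hy⟩ := this
      exact ⟨_, by rw [bernoulli'_def]; exact ReducesTo.one.sub (ReducesTo.sum _ _ _ hy)⟩
  choose! β hβ using h
  refine ⟨fun k => ((-1 : ℤ) : ZMod p) ^ k * β k, fun k hk => ?_⟩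
  have := ((ReducesTo.intCast (p := p) (-1)).pow k).mul (hβ k hk)
  rw [bernoulli]
  simpa using this

theorem sum_range_pow_zmod {p : ℕ} [Fact p.Prime] {β : ℕ → ZMod p}
    (hβ : ∀ k, k + 1 < p → ReducesTo p (bernoulli k) (β k)) {c : ℕ} (hc : c + 1 < p) (j : ℕ) :
    ∑ i ∈ Finset.range j, (i : ZMod p) ^ c =
      ∑ k ∈ Finset.range (c + 1),
        β k * ((c + 1).choose k : ZMod p) * (j : ZMod p) ^ (c + 1 - k) / ((c + 1 : ℕ) : ZMod p) := by
  refine ReducesTo.unique (q := ∑ i ∈ Finset.range j, (i : ℚ) ^ c)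
    (ReducesTo.sum _ _ _ fun i _ => (ReducesTo.natCast i).pow c) ?_
  rw [sum_range_pow]
  refine ReducesTo.sum _ _ _ fun k hk => ?_
  rw [Finset.mem_range] at hk
  have := (((hβ k (by omega)).mul (ReducesTo.natCast ((c + 1).choose k))).mul
    ((ReducesTo.natCast (p := p) j).pow (c + 1 - k))).div (ReducesTo.natCast (c + 1))
    (natCast_zmod_ne_zero (by omega) hc)
  simpa using this

/-! ### Nested sums over a finite set of indices -/

section NestedSums

variable {K : Type*} [CommRing K]

/-- `∑_{i < j} f i * g j`, with `i` and `j` in `s`. -/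
def strictSum₂ (s : Finset ℕ) (f g : ℕ → K) : K :=
  ∑ i ∈ s, ∑ j ∈ s, if i < j then f i * g j else 0

/-- `∑_{i < j < k} f i * g j * h k`, with `i`, `j`, `k` in `s`. -/
def strictSum₃ (s : Finset ℕ) (f g h : ℕ → K) : K :=
  ∑ i ∈ s, ∑ j ∈ s, ∑ k ∈ s, if i < j ∧ j < k then f i * g j * h k else 0

/-- `∑_{i ≤ j ≤ k} f i * g j * h k`, with `i`, `j`, `k` in `s`. -/
def weakSum₃ (s : Finset ℕ) (f g h : ℕ → K) : K :=
  ∑ i ∈ s, ∑ j ∈ s, ∑ k ∈ s, if i ≤ j ∧ j ≤ k then f i * g j * h k else 0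

theorem strictSum₂_congr {s : Finset ℕ} {f f' g g' : ℕ → K} (hf : ∀ i ∈ s, f i = f' i)
    (hg : ∀ i ∈ s, g i = g' i) : strictSum₂ s f g = strictSum₂ s f' g' := by
  refine Finset.sum_congr rfl fun i hi => Finset.sum_congr rfl fun j hj => ?_
  rw [hf i hi, hg j hj]

theorem strictSum₃_congr {s : Finset ℕ} {f f' g g' h h' : ℕ → K} (hf : ∀ i ∈ s, f i = f' i)
    (hg : ∀ i ∈ s, g i = g' i) (hh : ∀ i ∈ s, h i = h' i) :
    strictSum₃ s f g h = strictSum₃ s f' g' h' := by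
  refine Finset.sum_congr rfl fun i hi => Finset.sum_congr rfl fun j hj =>
    Finset.sum_congr rfl fun k hk => ?_
  rw [hf i hi, hg j hj, hh k hk]

theorem weakSum₃_eq (s : Finset ℕ) (f g h : ℕ → K) :
    weakSum₃ s f g h = strictSum₃ s f g h + strictSum₂ s (fun i => f i * g i) h +
      strictSum₂ s f (fun i => g i * h i) + ∑ i ∈ s, f i * g i * h i := by
  have h1 : strictSum₂ s (fun i => f i * g i) h = ∑ i ∈ s, ∑ j ∈ s, ∑ k ∈ s,
      if i = j ∧ j < k then f i * g j * h k else 0 := by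
    refine Finset.sum_congr rfl fun i hi => ?_
    rw [Finset.sum_comm]
    refine Finset.sum_congr rfl fun k _ => ?_
    simp only [ite_and]
    rw [Finset.sum_ite_eq, if_pos hi]
  have h2 : strictSum₂ s f (fun i => g i * h i) = ∑ i ∈ s, ∑ j ∈ s, ∑ k ∈ s,
      if i < j ∧ j = k then f i * g j * h k else 0 := by
    refine Finset.sum_congr rfl fun i _ => Finset.sum_congr rfl fun j hj => ?_
    simp only [and_comm (a := i < j), ite_and]
    rw [Finset.sum_ite_eq, if_pos hj, mul_assoc]
  have h3 : ∑ i ∈ s, f i * g i * h i = ∑ i ∈ s, ∑ j ∈ s, ∑ k ∈ s,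
      if i = j ∧ j = k then f i * g j * h k else 0 := by
    refine Finset.sum_congr rfl fun i hi => ?_
    rw [Finset.sum_comm]
    simp only [ite_and]
    simp only [Finset.sum_ite_eq, if_pos hi]
  rw [h1, h2, h3, weakSum₃, strictSum₃]
  simp only [← Finset.sum_add_distrib]
  refine Finset.sum_congr rfl fun i _ => Finset.sum_congr rfl fun j _ =>
    Finset.sum_congr rfl fun k _ => ?_
  split_ifs <;> first | (exfalso; omega) | ring

theorem sum_sum_sum_reverse (s : Finset ℕ) (F : ℕ → ℕ → ℕ → K) :
    ∑ i ∈ s, ∑ j ∈ s, ∑ k ∈ s, F i j k = ∑ k ∈ s, ∑ j ∈ s, ∑ i ∈ s, F i j k := by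
  rw [Finset.sum_comm]
  refine Eq.trans (Finset.sum_congr rfl fun j _ => Finset.sum_comm) ?_
  rw [Finset.sum_comm]

/-- The antipode relation in depth three. -/
theorem strictSum₃_eq_weakSum₃ (s : Finset ℕ) (f g h : ℕ → K) (hf : ∑ i ∈ s, f i = 0)
    (hh : ∑ i ∈ s, h i = 0) : strictSum₃ s f g h = weakSum₃ s h g f := by
  have h1 : ∑ i ∈ s, ∑ j ∈ s, ∑ k ∈ s, (if k ≤ j then f i * g j * h k else 0) = 0 := by
    calc _ = (∑ i ∈ s, f i) * ∑ j ∈ s, ∑ k ∈ s, (if k ≤ j then g j * h k else 0) := by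
          rw [Finset.sum_mul]
          refine Finset.sum_congr rfl fun i _ => ?_
          simp only [Finset.mul_sum, mul_ite, mul_zero, mul_assoc]
      _ = 0 := by rw [hf, zero_mul]
  have h2 : ∑ i ∈ s, ∑ j ∈ s, ∑ k ∈ s, (if i < j then f i * g j * h k else 0) = 0 := by
    refine Finset.sum_eq_zero fun i _ => Finset.sum_eq_zero fun j _ => ?_
    split_ifs
    · rw [← Finset.mul_sum, hh, mul_zero]
    · exact Finset.sum_const_zero
  have h3 : weakSum₃ s h g f = ∑ i ∈ s, ∑ j ∈ s, ∑ k ∈ s,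
      if k ≤ j ∧ j ≤ i then f i * g j * h k else 0 := by
    rw [weakSum₃, sum_sum_sum_reverse]
    refine Finset.sum_congr rfl fun i _ => Finset.sum_congr rfl fun j _ =>
      Finset.sum_congr rfl fun k _ => ?_
    rw [mul_comm (f i), mul_comm (h k), mul_assoc, mul_assoc, mul_comm (h k)]
  -- Pointwise, `[i<j<k] = [i<j] - [k≤j] + [k≤j≤i]`. The first two terms on the right leave `k`,
  -- respectively `i`, free, so they sum to zero.
  have h4 : strictSum₃ s f g h - weakSum₃ s h g f +
      ∑ i ∈ s, ∑ j ∈ s, ∑ k ∈ s, (if k ≤ j then f i * g j * h k else 0) -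
      ∑ i ∈ s, ∑ j ∈ s, ∑ k ∈ s, (if i < j then f i * g j * h k else 0) = 0 := by
    rw [h3, strictSum₃]
    simp only [← Finset.sum_add_distrib, ← Finset.sum_sub_distrib]
    refine Finset.sum_eq_zero fun i _ => Finset.sum_eq_zero fun j _ =>
      Finset.sum_eq_zero fun k _ => ?_
    split_ifs <;> first | (exfalso; omega) | ring
  rwa [h1, h2, add_zero, sub_zero, sub_eq_zero] at h4

theorem sum_involution (s : Finset ℕ) {σ : ℕ → ℕ} (hσ : ∀ i ∈ s, σ i ∈ s)
    (hσσ : ∀ i ∈ s, σ (σ i) = i) (F : ℕ → K) : ∑ i ∈ s, F i = ∑ i ∈ s, F (σ i) :=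
  Finset.sum_nbij' σ σ hσ hσ hσσ hσσ (fun i hi => by rw [hσσ i hi])

/-- The involution is later `i ↦ p - i`. Its properties are asked only on `s`, because natural
subtraction truncates elsewhere. -/
theorem strictSum₂_reverse (s : Finset ℕ) {σ : ℕ → ℕ} (hσ : ∀ i ∈ s, σ i ∈ s)
    (hσσ : ∀ i ∈ s, σ (σ i) = i) (hlt : ∀ i ∈ s, ∀ j ∈ s, σ i < σ j ↔ j < i) (f g : ℕ → K) :
    strictSum₂ s f g = strictSum₂ s (fun i => g (σ i)) (fun i => f (σ i)) := by
  have hs := sum_involution (K := K) s hσ hσσ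
  rw [strictSum₂, strictSum₂, Finset.sum_comm, hs]
  refine Finset.sum_congr rfl fun j hj => ?_
  rw [hs]
  refine Finset.sum_congr rfl fun i hi => ?_
  simp only [hlt i hi j hj, mul_comm]

theorem strictSum₃_reverse (s : Finset ℕ) {σ : ℕ → ℕ} (hσ : ∀ i ∈ s, σ i ∈ s)
    (hσσ : ∀ i ∈ s, σ (σ i) = i) (hlt : ∀ i ∈ s, ∀ j ∈ s, σ i < σ j ↔ j < i) (f g h : ℕ → K) :
    strictSum₃ s f g h = strictSum₃ s (fun i => h (σ i)) (fun i => g (σ i)) (fun i => f (σ i)) := by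
  have hs := sum_involution (K := K) s hσ hσσ
  rw [strictSum₃, strictSum₃, sum_sum_sum_reverse, hs]
  refine Finset.sum_congr rfl fun k hk => ?_
  rw [hs]
  refine Finset.sum_congr rfl fun j hj => ?_
  rw [hs]
  refine Finset.sum_congr rfl fun i hi => ?_
  simp only [hlt i hi j hj, hlt j hj k hk, and_comm (a := k < j)]
  congr 1
  ring

theorem sum_piFinset_fin_two (s : Finset ℕ) (F : (Fin 2 → ℕ) → K) :
    ∑ k ∈ Fintype.piFinset (fun _ : Fin 2 => s), F k = ∑ i ∈ s, ∑ j ∈ s, F ![i, j] := by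
  rw [← Finset.sum_product']
  refine Finset.sum_nbij' (fun k => (k 0, k 1)) (fun x => ![x.1, x.2]) ?_ ?_ ?_ ?_ ?_
  · intro k hk
    simp_all [Fintype.mem_piFinset]
  · intro x hx
    simp_all [Fintype.mem_piFinset, Fin.forall_fin_two]
  · intro k _
    ext i
    fin_cases i <;> rfl
  · intro x _
    rfl
  · intro k _
    congr 1
    ext i
    fin_cases i <;> rfl

theorem sum_piFinset_fin_three (s : Finset ℕ) (F : (Fin 3 → ℕ) → K) :
    ∑ k ∈ Fintype.piFinset (fun _ : Fin 3 => s), F k =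
      ∑ i ∈ s, ∑ j ∈ s, ∑ k ∈ s, F ![i, j, k] := by
  simp only [← Finset.sum_product']
  refine Finset.sum_nbij' (fun k => (k 0, k 1, k 2)) (fun x => ![x.1, x.2.1, x.2.2]) ?_ ?_ ?_ ?_ ?_
  · intro k hk
    simp_all [Fintype.mem_piFinset]
  · intro x hx
    simp_all [Fintype.mem_piFinset, Fin.forall_fin_succ]
  · intro k _
    ext i
    fin_cases i <;> rfl
  · intro x _
    rfl
  · intro k _
    congr 1
    ext i
    fin_cases i <;> rfl

end NestedSums

/-! ### Power sums, reflection and antipode in `ZMod p` -/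

section PrimeField

variable {p : ℕ} [Fact p.Prime]

/-- `i ↦ i⁻ᵃ` with values in `ZMod p`. -/
def invPow (p : ℕ) [Fact p.Prime] (a : ℤ) (i : ℕ) : ZMod p := (i : ZMod p) ^ (-a)

theorem natCast_ne_zero_of_mem {N i : ℕ} (hN : N < p) (hi : i ∈ Finset.Icc 1 N) :
    (i : ZMod p) ≠ 0 := by
  rw [Finset.mem_Icc] at hi
  exact natCast_zmod_ne_zero (by omega) (by omega)

theorem reducesTo_zpow {N i : ℕ} (hN : N < p) (hi : i ∈ Finset.Icc 1 N) (a : ℤ) :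
    ReducesTo p ((i : ℚ) ^ (-a)) (invPow p a i) :=
  (ReducesTo.natCast i).zpow (natCast_ne_zero_of_mem hN hi) _

theorem ReducesTo.ite {P : Prop} [Decidable P] {q : ℚ} {x : ZMod p} (h : ReducesTo p q x) :
    ReducesTo p (if P then q else 0) (if P then x else 0) := by
  split_ifs
  · exact h
  · exact ReducesTo.zero

theorem multHarmonicSum_two_reducesTo {N : ℕ} (hN : N < p) (a b : ℤ) :
    ReducesTo p (multHarmonicSum ![a, b] N)
      (strictSum₂ (Finset.Icc 1 N) (invPow p a) (invPow p b)) := by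
  rw [multHarmonicSum, Finset.sum_filter, sum_piFinset_fin_two]
  refine ReducesTo.sum _ _ _ fun i hi => ReducesTo.sum _ _ _ fun j hj => ?_
  have := ((reducesTo_zpow hN hi a).mul (reducesTo_zpow hN hj b)).ite (P := i < j)
  simp only [Fin.prod_univ_two]
  simpa [Fin.forall_fin_succ] using this

theorem multHarmonicSum_three_reducesTo {N : ℕ} (hN : N < p) (a b c : ℤ) :
    ReducesTo p (multHarmonicSum ![a, b, c] N)
      (strictSum₃ (Finset.Icc 1 N) (invPow p a) (invPow p b) (invPow p c)) := by
  rw [multHarmonicSum, Finset.sum_filter, sum_piFinset_fin_three]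
  refine ReducesTo.sum _ _ _ fun i hi => ReducesTo.sum _ _ _ fun j hj =>
    ReducesTo.sum _ _ _ fun k hk => ?_
  have h := (((reducesTo_zpow hN hi a).mul (reducesTo_zpow hN hj b)).mul
    (reducesTo_zpow hN hk c)).ite (P := i < j ∧ j < k)
  have e : (∀ x y : Fin 3, x < y → (![i, j, k] : Fin 3 → ℕ) x < (![i, j, k] : Fin 3 → ℕ) y) ↔
      i < j ∧ j < k := by
    simp [Fin.forall_fin_succ]
    omega
  simp only [e, Fin.prod_univ_three]
  exact h

theorem multHarmonicSumStar_three_reducesTo {N : ℕ} (hN : N < p) (a b c : ℤ) :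
    ReducesTo p (multHarmonicSumStar ![a, b, c] N)
      (weakSum₃ (Finset.Icc 1 N) (invPow p a) (invPow p b) (invPow p c)) := by
  rw [multHarmonicSumStar, Finset.sum_filter, sum_piFinset_fin_three]
  refine ReducesTo.sum _ _ _ fun i hi => ReducesTo.sum _ _ _ fun j hj =>
    ReducesTo.sum _ _ _ fun k hk => ?_
  have h := (((reducesTo_zpow hN hi a).mul (reducesTo_zpow hN hj b)).mul
    (reducesTo_zpow hN hk c)).ite (P := i ≤ j ∧ j ≤ k)
  have e : (∀ x y : Fin 3, x ≤ y → (![i, j, k] : Fin 3 → ℕ) x ≤ (![i, j, k] : Fin 3 → ℕ) y) ↔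
      i ≤ j ∧ j ≤ k := by
    simp [Fin.forall_fin_succ]
    omega
  simp only [e, Fin.prod_univ_three]
  exact h

theorem invPow_add {N i : ℕ} (hN : N < p) (hi : i ∈ Finset.Icc 1 N) (a b : ℤ) :
    invPow p (a + b) i = invPow p a i * invPow p b i := by
  rw [invPow, neg_add, zpow_add₀ (natCast_ne_zero_of_mem hN hi)]
  rfl

theorem invPow_zero (i : ℕ) : invPow p 0 i = 1 := by simp [invPow]

theorem invPow_sub_one {N i : ℕ} (hN : N < p) (hi : i ∈ Finset.Icc 1 N) (a : ℤ) :
    invPow p (a - 1) i = i * invPow p a i := by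
  rw [sub_eq_add_neg, invPow_add hN hi, mul_comm, invPow, neg_neg, zpow_one]

theorem invPow_congr {N i : ℕ} (hN : N < p) (hi : i ∈ Finset.Icc 1 N) {a b : ℤ}
    (h : a ≡ b [ZMOD (p - 1 : ℕ)]) : invPow p a i = invPow p b i := by
  obtain ⟨t, ht⟩ := h.dvd
  have hi0 := natCast_ne_zero_of_mem hN hi
  have e : -a = -b + ((p - 1 : ℕ) : ℤ) * t := by linarith
  rw [invPow, e, zpow_add₀ hi0, zpow_mul, zpow_natCast, ZMod.pow_card_sub_one_eq_one hi0, one_zpow,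
    mul_one, invPow]

theorem invPow_sub (a : ℤ) {i : ℕ} (hi : i ≤ p) :
    invPow p a (p - i) = (-1) ^ a * invPow p a i := by
  rw [invPow, Nat.cast_sub hi, ZMod.natCast_self, zero_sub, ← neg_one_mul, mul_zpow, invPow,
    zpow_neg, ← inv_zpow]
  norm_num

theorem sum_natCast_Icc_eq_sum_units (F : ZMod p → ZMod p) :
    ∑ i ∈ Finset.Icc 1 (p - 1), F (i : ZMod p) = ∑ x : (ZMod p)ˣ, F x := by
  have hp : 0 < p := (Fact.out : p.Prime).pos
  symm
  refine Finset.sum_bij (fun x _ => (x : ZMod p).val) ?_ ?_ ?_ ?_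
  · intro x _
    have h1 := ZMod.val_lt (x : ZMod p)
    have h2 : (x : ZMod p).val ≠ 0 := by
      rw [Ne, ZMod.val_eq_zero]
      exact x.ne_zero
    rw [Finset.mem_Icc]
    omega
  · intro x _ y _ h
    exact Units.ext (ZMod.val_injective p h)
  · intro i hi
    refine ⟨Units.mk0 (i : ZMod p) (natCast_ne_zero_of_mem (by omega) hi), Finset.mem_univ _, ?_⟩
    rw [Finset.mem_Icc] at hi
    exact ZMod.val_cast_of_lt (by omega)
  · intro x _
    rw [ZMod.natCast_zmod_val]

theorem sum_invPow (a : ℤ) : ∑ i ∈ Finset.Icc 1 (p - 1), invPow p a i =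
    if ((p - 1 : ℕ) : ℤ) ∣ a then -1 else 0 := by
  have hp : 1 < p := (Fact.out : p.Prime).one_lt
  -- A nonnegative representative of `-a` modulo `p - 1` turns integer powers into natural ones, for
  -- which the sum over units is known.
  obtain ⟨n, hn⟩ : ∃ n : ℕ, (n : ℤ) = (-a) % ((p - 1 : ℕ) : ℤ) :=
    ⟨_, Int.toNat_of_nonneg (Int.emod_nonneg _ (by omega))⟩
  have hmod : a ≡ -(n : ℤ) [ZMOD (p - 1 : ℕ)] := by
    have : (n : ℤ) ≡ -a [ZMOD (p - 1 : ℕ)] := by rw [hn]; exact Int.mod_modEq _ _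
    simpa using this.neg.symm
  have h1 : ∑ i ∈ Finset.Icc 1 (p - 1), invPow p a i =
      ∑ i ∈ Finset.Icc 1 (p - 1), (i : ZMod p) ^ n := by
    refine Finset.sum_congr rfl fun i hi => ?_
    rw [invPow_congr (by omega) hi hmod, invPow, neg_neg, zpow_natCast]
  rw [h1, sum_natCast_Icc_eq_sum_units (fun x => x ^ n), FiniteField.sum_pow_units, ZMod.card]
  refine if_congr ?_ rfl rfl
  rw [← Int.natCast_dvd_natCast, ← dvd_neg, ← Int.modEq_zero_iff_dvd, ← Int.modEq_zero_iff_dvd]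
  exact ⟨hmod.trans, hmod.symm.trans⟩

theorem sum_invPow_eq_zero {a : ℤ} (h : ¬ ((p - 1 : ℕ) : ℤ) ∣ a) :
    ∑ i ∈ Finset.Icc 1 (p - 1), invPow p a i = 0 := by
  rw [sum_invPow, if_neg h]

theorem strictSum₂_invPow_reverse (a b : ℤ) :
    strictSum₂ (Finset.Icc 1 (p - 1)) (invPow p a) (invPow p b) =
      (-1) ^ (a + b) * strictSum₂ (Finset.Icc 1 (p - 1)) (invPow p b) (invPow p a) := by
  have hp : 1 < p := (Fact.out : p.Prime).one_lt
  rw [strictSum₂_reverse _ (σ := fun i => p - i)]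
  · simp only [strictSum₂, Finset.mul_sum]
    refine Finset.sum_congr rfl fun i hi => Finset.sum_congr rfl fun j hj => ?_
    rw [Finset.mem_Icc] at hi hj
    rw [invPow_sub a (by omega), invPow_sub b (by omega), zpow_add₀ (by simp)]
    split_ifs <;> ring
  all_goals simp only [Finset.mem_Icc]; intros; omega

theorem strictSum₃_invPow_reverse (a b c : ℤ) :
    strictSum₃ (Finset.Icc 1 (p - 1)) (invPow p a) (invPow p b) (invPow p c) =
      (-1) ^ (a + b + c) *
        strictSum₃ (Finset.Icc 1 (p - 1)) (invPow p c) (invPow p b) (invPow p a) := by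
  have hp : 1 < p := (Fact.out : p.Prime).one_lt
  rw [strictSum₃_reverse _ (σ := fun i => p - i)]
  · simp only [strictSum₃, Finset.mul_sum]
    refine Finset.sum_congr rfl fun i hi => Finset.sum_congr rfl fun j hj =>
      Finset.sum_congr rfl fun k hk => ?_
    rw [Finset.mem_Icc] at hi hj hk
    rw [invPow_sub a (by omega), invPow_sub b (by omega), invPow_sub c (by omega),
      zpow_add₀ (by simp), zpow_add₀ (by simp)]
    split_ifs <;> ring
  all_goals simp only [Finset.mem_Icc]; intros; omega

/-- In odd weight, the antipode and the reflection `k ↦ p - k` express a triple sum by double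
sums. -/
theorem strictSum₃_invPow_of_odd_weight {a b c : ℤ} (hodd : Odd (a + b + c)) (hp2 : p ≠ 2)
    (ha : ¬ ((p - 1 : ℕ) : ℤ) ∣ a) (hc : ¬ ((p - 1 : ℕ) : ℤ) ∣ c) :
    strictSum₃ (Finset.Icc 1 (p - 1)) (invPow p a) (invPow p b) (invPow p c) =
        weakSum₃ (Finset.Icc 1 (p - 1)) (invPow p c) (invPow p b) (invPow p a) ∧
      2 * strictSum₃ (Finset.Icc 1 (p - 1)) (invPow p a) (invPow p b) (invPow p c) =
        strictSum₂ (Finset.Icc 1 (p - 1)) (invPow p (c + b)) (invPow p a) -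
          strictSum₂ (Finset.Icc 1 (p - 1)) (invPow p (a + b)) (invPow p c) := by
  have hp : 1 < p := (Fact.out : p.Prime).one_lt
  have h1 := strictSum₃_eq_weakSum₃ _ (invPow p a) (invPow p b) (invPow p c)
    (sum_invPow_eq_zero ha) (sum_invPow_eq_zero hc)
  refine ⟨h1, ?_⟩
  have h2 := strictSum₃_invPow_reverse (p := p) c b a
  have h3 : strictSum₂ (Finset.Icc 1 (p - 1)) (fun i => invPow p c i * invPow p b i) (invPow p a) =
      strictSum₂ (Finset.Icc 1 (p - 1)) (invPow p (c + b)) (invPow p a) :=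
    strictSum₂_congr (fun i hi => (invPow_add (by omega) hi c b).symm) fun _ _ => rfl
  have h4 : strictSum₂ (Finset.Icc 1 (p - 1)) (invPow p c) (fun i => invPow p b i * invPow p a i) =
      strictSum₂ (Finset.Icc 1 (p - 1)) (invPow p c) (invPow p (a + b)) :=
    strictSum₂_congr (fun _ _ => rfl) fun i hi => by
      rw [invPow_add (by omega) hi a b, mul_comm]
  have h5 : ∑ i ∈ Finset.Icc 1 (p - 1), invPow p c i * invPow p b i * invPow p a i = 0 := by
    -- The even number `p - 1` cannot divide an odd weight.
    have : ¬ ((p - 1 : ℕ) : ℤ) ∣ c + b + a := fun h => by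
      have hpo := (Fact.out : p.Prime).odd_of_ne_two hp2
      obtain ⟨r, hr⟩ := hodd
      obtain ⟨q, hq⟩ := hpo
      obtain ⟨t, ht⟩ := h
      have e : ((p - 1 : ℕ) : ℤ) = 2 * q := by omega
      rw [e, mul_assoc] at ht
      omega
    rw [← sum_invPow_eq_zero this]
    refine Finset.sum_congr rfl fun i hi => ?_
    rw [invPow_add (by omega) hi, invPow_add (by omega) hi]
  have hodd' : Odd (c + b + a) := by
    rwa [show c + b + a = a + b + c by ring]
  have hodd'' : Odd (c + (a + b)) := by rwa [add_comm]
  rw [hodd'.neg_one_zpow] at h2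
  have h6 := strictSum₂_invPow_reverse (p := p) c (a + b)
  rw [hodd''.neg_one_zpow] at h6
  rw [weakSum₃_eq, h3, h4, h5, h2, h6] at h1
  linear_combination h1

end PrimeField

/-! ### Evaluation of double sums -/

section DoubleSums

variable {p : ℕ} [Fact p.Prime]

/-- Modulo `p`, `p - a - i` is `-(a + i)`, so the falling factorial of `p - a` is, up to sign, the
rising factorial of `a`. This converts the Faulhaber coefficient into the binomial coefficient of
the theorem. -/
theorem choose_prime_sub_div {a b : ℕ} (ha : 0 < a) (hab : a + b < p) :
    ((p - a).choose b : ZMod p) / ((p - a : ℕ) : ZMod p) =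
      (-1) ^ (b + 1) * ((a + b).choose b : ZMod p) / ((a + b : ℕ) : ZMod p) := by
  have hcast (i : ℕ) (hi : i < b) : ((p - a - i : ℕ) : ZMod p) = -((a + i : ℕ) : ZMod p) := by
    rw [eq_neg_iff_add_eq_zero, ← Nat.cast_add, show p - a - i + (a + i) = p by omega,
      ZMod.natCast_self]
  have h1 : ((p - a).descFactorial b : ZMod p) = (-1) ^ b * (a.ascFactorial b : ZMod p) := by
    rw [Nat.descFactorial_eq_prod_range, Nat.ascFactorial_eq_prod_range, Nat.cast_prod,
      Nat.cast_prod, Finset.prod_congr rfl fun i hi => hcast i (Finset.mem_range.1 hi),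
      Finset.prod_neg, Finset.card_range]
  have hfact : (b.factorial : ZMod p) ≠ 0 := by
    rw [Ne, ZMod.natCast_eq_zero_iff, (Fact.out : p.Prime).dvd_factorial]
    omega
  rw [Nat.descFactorial_eq_factorial_mul_choose, Nat.ascFactorial_eq_factorial_mul_choose',
    Nat.cast_mul, Nat.cast_mul, mul_left_comm] at h1
  have h2 := mul_left_cancel₀ hfact h1
  have ha0 : (a : ZMod p) ≠ 0 := natCast_zmod_ne_zero ha (by omega)
  have hab0 : ((a + b : ℕ) : ZMod p) ≠ 0 := natCast_zmod_ne_zero (by omega) hab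
  have h3 : ((p - a : ℕ) : ZMod p) = -a := by
    rw [Nat.cast_sub (by omega), ZMod.natCast_self, zero_sub]
  have h4 : (a + b).choose b * a = (a + b) * (a + b - 1).choose b := by
    have := Nat.choose_mul_succ_eq (a + b - 1) b
    rw [show a + b - 1 + 1 = a + b by omega, show a + b - b = a by omega] at this
    linarith
  have h5 : ((a + b).choose b : ZMod p) * a = ((a + b : ℕ) : ZMod p) * ((a + b - 1).choose b) := by
    exact_mod_cast congrArg (Nat.cast : ℕ → ZMod p) h4
  rw [h2, h3, div_eq_div_iff (neg_ne_zero.2 ha0) hab0, pow_succ]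
  linear_combination -(-1) ^ b * h5

theorem sum_invPow_lt {a j : ℕ} (ha : a + 1 < p) (hj : j ∈ Finset.Icc 1 (p - 1)) :
    ∑ i ∈ Finset.Icc 1 (p - 1), (if i < j then invPow p a i else 0) =
      ∑ i ∈ Finset.range j, (i : ZMod p) ^ (p - 1 - a) := by
  have hmod : (a : ℤ) ≡ -((p - 1 - a : ℕ) : ℤ) [ZMOD (p - 1 : ℕ)] := by
    refine (Int.modEq_iff_dvd.2 ⟨-1, ?_⟩)
    push_cast [Nat.cast_sub (show a ≤ p - 1 by omega)]
    ring
  rw [← Finset.sum_filter]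
  refine Finset.sum_subset_zero_on_sdiff ?_ ?_ ?_
  · intro i hi
    simp only [Finset.mem_filter] at hi
    exact Finset.mem_range.2 hi.2
  · intro i hi
    simp only [Finset.mem_sdiff, Finset.mem_range, Finset.mem_filter, Finset.mem_Icc] at hi hj
    have : i = 0 := by omega
    -- The extra index `0` contributes nothing because `p - 1 - a > 0`.
    rw [this, Nat.cast_zero, zero_pow (by omega)]
  · intro i hi
    rw [invPow_congr (by omega) (Finset.mem_filter.1 hi).1 hmod, invPow, neg_neg, zpow_natCast]

/-- After Faulhaber, the `k`-th term carries the power sum of exponent `a + b + k - p`. It is `-1`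
if `p - 1` divides this exponent and `0` otherwise, which singles out `k = p - (a + b)`. -/
theorem strictSum₂_invPow_eq {β : ℕ → ZMod p}
    (hβ : ∀ k, k + 1 < p → ReducesTo p (bernoulli k) (β k)) {a b : ℕ} (ha : 0 < a)
    (hap : a + 1 < p) (hb : 0 < b) (hbp : b + 1 < p) :
    strictSum₂ (Finset.Icc 1 (p - 1)) (invPow p a) (invPow p b) =
      if a + b ≤ p then
        -(β (p - (a + b)) * ((p - a).choose (p - (a + b)) : ZMod p) / ((p - a : ℕ) : ZMod p))
      else 0 := by
  have key (j : ℕ) (hj : j ∈ Finset.Icc 1 (p - 1)) :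
      ∑ i ∈ Finset.Icc 1 (p - 1), (if i < j then invPow p a i * invPow p b j else 0) =
      ∑ k ∈ Finset.range (p - a), β k * ((p - a).choose k : ZMod p) / ((p - a : ℕ) : ZMod p) *
        invPow p ((a + b + k : ℤ) - p) j := by
    have h1 := sum_invPow_lt hap hj
    rw [sum_range_pow_zmod hβ (by omega), show p - 1 - a + 1 = p - a by omega] at h1
    simp only [← ite_zero_mul]
    rw [← Finset.sum_mul, h1, Finset.sum_mul]
    refine Finset.sum_congr rfl fun k hk => ?_
    rw [Finset.mem_range] at hk
    have e : ((a + b + k : ℤ) - p) = -((p - a - k : ℕ) : ℤ) + b := by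
      have : ((p - a - k : ℕ) : ℤ) = p - a - k := by omega
      rw [this]
      ring
    rw [e, invPow_add (by omega) hj, invPow.eq_1 p (-_), neg_neg, zpow_natCast]
    ring
  have hdvd (k : ℕ) (hk : k ∈ Finset.range (p - a)) :
      ((p - 1 : ℕ) : ℤ) ∣ (a + b + k : ℤ) - p ↔ a + b + k = p := by
    rw [Finset.mem_range] at hk
    constructor
    · intro h
      -- As `a + b ≥ 2` and `k < p - a`, the exponent lies strictly between `-(p - 1)` and `p - 1`.
      have := Int.eq_zero_of_abs_lt_dvd h (by rw [abs_lt]; omega)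
      omega
    · intro h
      rw [show (a + b + k : ℤ) - p = 0 by omega]
      exact dvd_zero _
  rw [strictSum₂, Finset.sum_comm, Finset.sum_congr rfl key, Finset.sum_comm]
  simp only [← Finset.mul_sum, sum_invPow]
  split_ifs with h
  · rw [Finset.sum_eq_single (p - (a + b))]
    · rw [if_pos ((hdvd _ (Finset.mem_range.2 (by omega))).2 (by omega))]
      ring
    · intro k hk hne
      rw [if_neg (by rw [hdvd k hk]; omega), mul_zero]
    · intro hn
      rw [Finset.mem_range] at hn
      omega
  · refine Finset.sum_eq_zero fun k hk => ?_
    rw [if_neg (by rw [hdvd k hk]; omega), mul_zero]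

theorem two_ne_zero_zmod (hp2 : p ≠ 2) : (2 : ZMod p) ≠ 0 := by
  have h := (Fact.out : p.Prime).two_le
  exact_mod_cast natCast_zmod_ne_zero (p := p) two_pos (by omega)

theorem bernoulli_term_reducesTo (hp2 : p ≠ 2) {a b : ℕ} (ha : 0 < a) (hb : 0 < b)
    (hab : a + b < p) :
    ReducesTo p ((-1) ^ (b + 1) * ((a + b).choose b : ℚ) *
        (bernoulli (p - (a + b)) / (2 * ((a + b : ℕ) : ℚ))))
      (-strictSum₂ (Finset.Icc 1 (p - 1)) (invPow p a) (invPow p b) / 2) := by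
  obtain ⟨β, hβ⟩ := bernoulli_reducesTo p
  have h2 := two_ne_zero_zmod hp2
  have hab0 : ((a + b : ℕ) : ZMod p) ≠ 0 := natCast_zmod_ne_zero (by omega) hab
  have h := ((((ReducesTo.intCast (p := p) (-1)).pow (b + 1)).mul
    (ReducesTo.natCast ((a + b).choose b))).mul ((hβ (p - (a + b)) (by omega)).div
      ((ReducesTo.natCast (p := p) 2).mul (ReducesTo.natCast (a + b)))
      (mul_ne_zero (by exact_mod_cast h2) hab0)))
  have e : (p - a).choose (p - (a + b)) = (p - a).choose b := by
    rw [← Nat.choose_symm (show b ≤ p - a by omega)]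
    congr 1
    omega
  have hc := choose_prime_sub_div ha hab
  rw [strictSum₂_invPow_eq hβ ha (by omega) hb (by omega), if_pos hab.le, e, neg_neg, mul_div_assoc,
    hc]
  convert h using 1
  · push_cast; ring
  · push_cast
    field_simp

theorem inv_two_mul_reducesTo (hp2 : p ≠ 2) {a b : ℕ} (ha : 0 < a) (hap : a + 1 < p) (hb : 0 < b)
    (hbp : b + 1 < p) (hab : a + b = p) :
    ReducesTo p (1 / (2 * (b : ℚ)))
      (-strictSum₂ (Finset.Icc 1 (p - 1)) (invPow p a) (invPow p b) / 2) := by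
  obtain ⟨β, hβ⟩ := bernoulli_reducesTo p
  have h2 := two_ne_zero_zmod hp2
  have hb0 : (b : ZMod p) ≠ 0 := natCast_zmod_ne_zero hb (by omega)
  have h := ReducesTo.one.div ((ReducesTo.natCast (p := p) 2).mul (ReducesTo.natCast b))
    (mul_ne_zero (by exact_mod_cast h2) hb0)
  have hβ0 : β 0 = 1 := (hβ 0 (by omega)).unique (by simpa using ReducesTo.one)
  rw [strictSum₂_invPow_eq hβ ha hap hb hbp, if_pos hab.le, hab, Nat.sub_self, hβ0,
    show p - a = b by omega, neg_neg]
  convert h using 1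
  · push_cast; rfl
  · rw [Nat.choose_zero_right]
    push_cast
    field_simp

/-- The case `l + m = p - 1`, outside the range of the Faulhaber evaluation: the first factor is
constantly `1`, and the inner sum counts `j - 1` indices. -/
theorem strictSum₂_one_invPow {b : ℕ} (hb : 0 < b) (hbp : b + 1 < p) :
    strictSum₂ (Finset.Icc 1 (p - 1)) (invPow p (p - 1 : ℕ)) (invPow p b) =
      if b = 1 then -1 else 0 := by
  have key (j : ℕ) (hj : j ∈ Finset.Icc 1 (p - 1)) : ∑ i ∈ Finset.Icc 1 (p - 1),
      (if i < j then invPow p (p - 1 : ℕ) i * invPow p b j else 0) =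
        invPow p (b - 1) j - invPow p b j := by
    have h1 : ∑ i ∈ Finset.Icc 1 (p - 1), (if i < j then invPow p (p - 1 : ℕ) i * invPow p b j
        else 0) = ∑ i ∈ (Finset.Icc 1 (p - 1)).filter (· < j), invPow p b j := by
      rw [Finset.sum_filter]
      refine Finset.sum_congr rfl fun i hi => ?_
      have : invPow p (p - 1 : ℕ) i = 1 := by
        rw [← invPow_zero (p := p) i]
        exact invPow_congr (by omega) hi (Int.modEq_zero_iff_dvd.2 dvd_rfl)
      rw [this, one_mul]
    have h2 : (Finset.Icc 1 (p - 1)).filter (· < j) = Finset.Ico 1 j := by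
      ext i
      simp only [Finset.mem_Icc, Finset.mem_filter, Finset.mem_Ico] at hj ⊢
      omega
    rw [h1, h2, Finset.sum_const, Nat.card_Ico, nsmul_eq_mul, invPow_sub_one (by omega) hj,
      Nat.cast_sub (Finset.mem_Icc.1 hj).1]
    push_cast
    ring
  have hnd : ¬ ((p - 1 : ℕ) : ℤ) ∣ b := by
    rw [Int.natCast_dvd_natCast]
    exact Nat.not_dvd_of_pos_of_lt hb (by omega)
  rw [strictSum₂, Finset.sum_comm, Finset.sum_congr rfl key, Finset.sum_sub_distrib,
    sum_invPow_eq_zero hnd, sum_invPow, sub_zero]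
  refine if_congr ?_ rfl rfl
  rw [show (b : ℤ) - 1 = ((b - 1 : ℕ) : ℤ) by omega, Int.natCast_dvd_natCast]
  constructor
  · intro h
    have := Nat.eq_zero_of_dvd_of_lt h (by omega)
    omega
  · rintro rfl
    exact dvd_zero _

theorem oddTripleI_reducesTo (hp2 : p ≠ 2) {l m n : ℕ} (hl : 0 < l) (hm : 0 < m) (hn : 0 < n)
    (hlp : l + 1 < p) (hmp : m + 1 < p) (hnp : n + 1 < p) :
    ReducesTo p (oddTripleI p l m n)
      (-strictSum₂ (Finset.Icc 1 (p - 1)) (invPow p (l + m)) (invPow p n) / 2) := by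
  have hred {a : ℕ} (ha : l + m = a + (p - 1)) :
      strictSum₂ (Finset.Icc 1 (p - 1)) (invPow p (l + m)) (invPow p n) =
        strictSum₂ (Finset.Icc 1 (p - 1)) (invPow p a) (invPow p n) := by
    refine strictSum₂_congr (fun i hi => invPow_congr (by omega) hi ?_) fun _ _ => rfl
    refine (Int.modEq_iff_dvd.2 ⟨-1, ?_⟩)
    have : (l + m : ℤ) = a + ((p - 1 : ℕ) : ℤ) := by exact_mod_cast ha
    rw [this]
    ring
  have hcast : ((l : ℤ) + m) = ((l + m : ℕ) : ℤ) := by push_cast; rfl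
  rw [oddTripleI]
  rcases lt_trichotomy (l + m) (p - 1) with h | h | h
  · rw [hcast]
    rcases lt_trichotomy (l + m + n) p with h' | h' | h'
    · rw [if_neg (by omega), if_neg (by omega), reducedWeight, if_neg (by omega)]
      exact bernoulli_term_reducesTo hp2 (by omega) hn h'
    · rw [if_neg (by omega), if_pos (by omega)]
      exact inv_two_mul_reducesTo hp2 (by omega) (by omega) hn hnp h'
    · obtain ⟨β, hβ⟩ := bernoulli_reducesTo p
      rw [if_pos (by omega), strictSum₂_invPow_eq hβ (by omega) (by omega) hn hnp,
        if_neg (by omega)]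
      simpa using ReducesTo.zero
  · rw [hcast, h, strictSum₂_one_invPow hn hnp]
    -- Here the weight is `p - 1 + n`: it equals `p` when `n = 1`, and otherwise lies strictly
    -- between `p` and `2p - 1`.
    split_ifs with h1 h2 h3 h4 h5
    · omega
    · simpa using ReducesTo.zero
    · subst h4
      have := (ReducesTo.one (p := p)).div (ReducesTo.natCast 2)
        (by exact_mod_cast two_ne_zero_zmod hp2)
      simpa using this
    · omega
    · omega
    · omega
  · obtain ⟨a, ha⟩ : ∃ a, l + m = a + (p - 1) := ⟨l + m - (p - 1), by omega⟩
    rw [hred ha]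
    rcases lt_trichotomy (a + n) p with h' | h' | h'
    · rw [if_neg (by omega), if_neg (by omega), reducedWeight, if_pos (by omega),
        show l + m + n - (p - 1) = a + n by omega]
      exact bernoulli_term_reducesTo hp2 (by omega) hn h'
    · rw [if_neg (by omega), if_pos (by omega)]
      exact inv_two_mul_reducesTo hp2 (by omega) (by omega) hn hnp h'
    · obtain ⟨β, hβ⟩ := bernoulli_reducesTo p
      rw [if_pos (by omega), strictSum₂_invPow_eq hβ (by omega) (by omega) hn hnp,
        if_neg (by omega)]
      simpa using ReducesTo.zero

end DoubleSums

theorem not_prime_sub_one_dvd {p l : ℕ} (hl : 0 < l) (hlp : l + 1 < p) :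
    ¬ ((p - 1 : ℕ) : ℤ) ∣ l := by
  rw [Int.natCast_dvd_natCast]
  exact Nat.not_dvd_of_pos_of_lt hl (by omega)

/-! ### Zero exponents and the odd-weight formula -/

section Reductions

variable {p : ℕ} [Fact p.Prime]

theorem sum_Icc_lt_const {N j : ℕ} (hj : j ∈ Finset.Icc 1 N) (x : ZMod p) :
    ∑ i ∈ Finset.Icc 1 N, (if i < j then x else 0) = (j - 1) * x := by
  rw [← Finset.sum_filter, show (Finset.Icc 1 N).filter (· < j) = Finset.Ico 1 j by
    ext i; simp only [Finset.mem_Icc, Finset.mem_filter, Finset.mem_Ico] at hj ⊢; omega,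
    Finset.sum_const, Nat.card_Ico, nsmul_eq_mul, Nat.cast_sub (Finset.mem_Icc.1 hj).1,
    Nat.cast_one]

theorem sum_Icc_gt_const {N j : ℕ} (hj : j ∈ Finset.Icc 1 N) (x : ZMod p) :
    ∑ i ∈ Finset.Icc 1 N, (if j < i then x else 0) = (N - j) * x := by
  rw [← Finset.sum_filter, show (Finset.Icc 1 N).filter (j < ·) = Finset.Ioc j N by
    ext i; simp only [Finset.mem_Icc, Finset.mem_filter, Finset.mem_Ioc] at hj ⊢; omega,
    Finset.sum_const, Nat.card_Ioc, nsmul_eq_mul, Nat.cast_sub (Finset.mem_Icc.1 hj).2]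

theorem sum_Icc_between_const {N i j : ℕ} (hi : i ∈ Finset.Icc 1 N) (hj : j ∈ Finset.Icc 1 N)
    (x : ZMod p) :
    ∑ k ∈ Finset.Icc 1 N, (if i < k ∧ k < j then x else 0) =
      if i < j then (j - 1 - i) * x else 0 := by
  rw [← Finset.sum_filter, show (Finset.Icc 1 N).filter (fun k => i < k ∧ k < j) = Finset.Ioo i j by
    ext k; simp only [Finset.mem_Icc, Finset.mem_filter, Finset.mem_Ioo] at hi hj ⊢; omega,
    Finset.sum_const, Nat.card_Ioo, nsmul_eq_mul]
  split_ifs with h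
  · rw [Nat.sub_right_comm, Nat.cast_sub (by omega), Nat.cast_sub (by omega), Nat.cast_one]
  · rw [show j - i - 1 = 0 by omega, Nat.cast_zero, zero_mul]

theorem strictSum₃_invPow_zero_left {N : ℕ} (hN : N < p) (b c : ℤ) :
    strictSum₃ (Finset.Icc 1 N) (invPow p 0) (invPow p b) (invPow p c) =
      strictSum₂ (Finset.Icc 1 N) (invPow p (b - 1)) (invPow p c) -
        strictSum₂ (Finset.Icc 1 N) (invPow p b) (invPow p c) := by
  simp only [strictSum₃, strictSum₂, ← Finset.sum_sub_distrib]
  rw [Finset.sum_comm]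
  refine Finset.sum_congr rfl fun j hj => ?_
  rw [Finset.sum_comm]
  refine Finset.sum_congr rfl fun k hk => ?_
  rw [invPow_sub_one hN hj]
  simp only [invPow_zero, one_mul, ite_and]
  rw [sum_Icc_lt_const hj]
  split_ifs <;> ring

theorem strictSum₃_invPow_zero_middle {N : ℕ} (hN : N < p) (a c : ℤ) :
    strictSum₃ (Finset.Icc 1 N) (invPow p a) (invPow p 0) (invPow p c) =
      strictSum₂ (Finset.Icc 1 N) (invPow p a) (invPow p (c - 1)) -
        strictSum₂ (Finset.Icc 1 N) (invPow p a) (invPow p c) -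
        strictSum₂ (Finset.Icc 1 N) (invPow p (a - 1)) (invPow p c) := by
  simp only [strictSum₃, strictSum₂, ← Finset.sum_sub_distrib]
  refine Finset.sum_congr rfl fun i hi => ?_
  rw [Finset.sum_comm]
  refine Finset.sum_congr rfl fun k hk => ?_
  rw [invPow_sub_one hN hi, invPow_sub_one hN hk]
  simp only [invPow_zero, mul_one]
  rw [sum_Icc_between_const hi hk]
  split_ifs <;> ring

/-- There are `p - 1 - j` indices above `j`, which is `-1 - j` modulo `p`; hence the upper limit
must be `p - 1`. -/
theorem strictSum₃_invPow_zero_right (a b : ℤ) :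
    strictSum₃ (Finset.Icc 1 (p - 1)) (invPow p a) (invPow p b) (invPow p 0) =
      -strictSum₂ (Finset.Icc 1 (p - 1)) (invPow p a) (invPow p (b - 1)) -
        strictSum₂ (Finset.Icc 1 (p - 1)) (invPow p a) (invPow p b) := by
  have hp : 1 < p := (Fact.out : p.Prime).one_lt
  simp only [strictSum₃, strictSum₂, ← Finset.sum_sub_distrib, ← Finset.sum_neg_distrib]
  refine Finset.sum_congr rfl fun i hi => Finset.sum_congr rfl fun j hj => ?_
  rw [invPow_sub_one (by omega) hj]
  simp only [invPow_zero, mul_one, and_comm (a := i < j), ite_and]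
  rw [sum_Icc_gt_const hj, Nat.cast_sub hp.le, ZMod.natCast_self]
  split_ifs <;> push_cast <;> ring

theorem strictSum₃_reducesTo_oddTripleI_sub (hp2 : p ≠ 2) {l m n : ℕ} (hl : 0 < l) (hm : 0 < m)
    (hn : 0 < n) (hlp : l + 1 < p) (hmp : m + 1 < p) (hnp : n + 1 < p) (hodd : Odd (l + m + n)) :
    ReducesTo p (oddTripleI p l m n - oddTripleI p n m l)
      (strictSum₃ (Finset.Icc 1 (p - 1)) (invPow p l) (invPow p m) (invPow p n)) := by
  have h := (oddTripleI_reducesTo hp2 hl hm hn hlp hmp hnp).sub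
    (oddTripleI_reducesTo hp2 hn hm hl hnp hmp hlp)
  have hodd' : Odd (l + m + n : ℤ) := by exact_mod_cast hodd
  have h2 := (strictSum₃_invPow_of_odd_weight hodd' hp2 (not_prime_sub_one_dvd hl hlp)
    (not_prime_sub_one_dvd hn hnp)).2
  have h3 := two_ne_zero_zmod (p := p) hp2
  convert h using 1
  rw [← mul_right_inj' h3, h2]
  field_simp
  ring

end Reductions

/-! ### The main theorem -/

theorem oddTripleI_of_lt {p l m n : ℕ} (h : l + m + n < p) :
    oddTripleI p l m n = (-1) ^ (n + 1) * ((l + m + n).choose n : ℚ) *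
      (bernoulli (p - (l + m + n)) / (2 * ((l + m + n : ℕ) : ℚ))) := by
  rw [oddTripleI, if_neg (by omega), if_neg (by omega), reducedWeight, if_neg (by omega)]

theorem mainTheorem3 (p : ℕ) (hp : p.Prime) (hp2 : p ≠ 2) :
    (∀ s₁ s₂ s₃ l m n : ℕ, 0 < s₁ → 0 < s₂ → 0 < s₃ →
      l ≤ p - 2 → m ≤ p - 2 → n ≤ p - 2 →
      s₁ ≡ l [MOD p - 1] → s₂ ≡ m [MOD p - 1] → s₃ ≡ n [MOD p - 1] →
        RatModEq p (multHarmonicSum ![(s₁ : ℤ), (s₂ : ℤ), (s₃ : ℤ)] (p - 1))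
          (multHarmonicSum ![(l : ℤ), (m : ℤ), (n : ℤ)] (p - 1)) ∧
        RatModEq p (multHarmonicSum ![0, (m : ℤ), (n : ℤ)] (p - 1))
          (multHarmonicSum ![(m : ℤ) - 1, (n : ℤ)] (p - 1)
            - multHarmonicSum ![(m : ℤ), (n : ℤ)] (p - 1)) ∧
        RatModEq p (multHarmonicSum ![(l : ℤ), 0, (n : ℤ)] (p - 1))
          (multHarmonicSum ![(l : ℤ), (n : ℤ) - 1] (p - 1)
            - multHarmonicSum ![(l : ℤ), (n : ℤ)] (p - 1)
            - multHarmonicSum ![(l : ℤ) - 1, (n : ℤ)] (p - 1)) ∧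
        RatModEq p (multHarmonicSum ![(l : ℤ), (m : ℤ), 0] (p - 1))
          (-multHarmonicSum ![(l : ℤ), (m : ℤ) - 1] (p - 1)
            - multHarmonicSum ![(l : ℤ), (m : ℤ)] (p - 1)) ∧
        (1 ≤ l → 1 ≤ m → 1 ≤ n → Odd (l + m + n) →
          RatModEq p (multHarmonicSum ![(l : ℤ), (m : ℤ), (n : ℤ)] (p - 1))
            (oddTripleI p l m n - oddTripleI p n m l))) ∧
    (∀ l m n : ℕ, 1 ≤ l → 1 ≤ m → 1 ≤ n → Odd (l + m + n) → l + m + n < p →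
      RatModEq p (multHarmonicSum ![(l : ℤ), (m : ℤ), (n : ℤ)] (p - 1))
        (-multHarmonicSumStar ![(l : ℤ), (m : ℤ), (n : ℤ)] (p - 1)) ∧
      RatModEq p (-multHarmonicSumStar ![(l : ℤ), (m : ℤ), (n : ℤ)] (p - 1))
        (((-1) ^ l * (Nat.choose (l + m + n) l : ℚ) - (-1) ^ n * (Nat.choose (l + m + n) n : ℚ))
          * (bernoulli (p - (l + m + n)) / (2 * ((l + m + n : ℕ) : ℚ))))) := by
  have : Fact p.Prime := ⟨hp⟩
  have hp1 : p - 1 < p := Nat.sub_lt hp.pos one_pos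
  have hp3 : 2 < p := lt_of_le_of_ne hp.two_le (Ne.symm hp2)
  have H₂ := multHarmonicSum_two_reducesTo hp1
  have H₃ := multHarmonicSum_three_reducesTo hp1
  constructor
  · intro s₁ s₂ s₃ l m n _ _ _ hl hm hn h₁ h₂ h₃
    refine ⟨?_, ?_, ?_, ?_, ?_⟩
    · refine (H₃ _ _ _).ratModEq ?_
      rw [strictSum₃_congr (fun i hi => invPow_congr hp1 hi (Int.natCast_modEq_iff.2 h₁))
        (fun i hi => invPow_congr hp1 hi (Int.natCast_modEq_iff.2 h₂))
        (fun i hi => invPow_congr hp1 hi (Int.natCast_modEq_iff.2 h₃))]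
      exact H₃ _ _ _
    · refine (H₃ _ _ _).ratModEq ?_
      rw [strictSum₃_invPow_zero_left hp1]
      exact (H₂ _ _).sub (H₂ _ _)
    · refine (H₃ _ _ _).ratModEq ?_
      rw [strictSum₃_invPow_zero_middle hp1]
      exact ((H₂ _ _).sub (H₂ _ _)).sub (H₂ _ _)
    · refine (H₃ _ _ _).ratModEq ?_
      rw [strictSum₃_invPow_zero_right]
      exact (H₂ _ _).neg.sub (H₂ _ _)
    · intro hl0 hm0 hn0 hodd
      exact (H₃ _ _ _).ratModEq (strictSum₃_reducesTo_oddTripleI_sub hp2 hl0 hm0 hn0 (by omega)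
        (by omega) (by omega) hodd)
  · intro l m n hl hm hn hodd hw
    have hS : ReducesTo p (-multHarmonicSumStar ![(l : ℤ), (m : ℤ), (n : ℤ)] (p - 1))
        (strictSum₃ (Finset.Icc 1 (p - 1)) (invPow p l) (invPow p m) (invPow p n)) := by
      have hodd' : Odd (l + m + n : ℤ) := by exact_mod_cast hodd
      have hodd'' : Odd (n + m + l : ℤ) := by
        rwa [show (n + m + l : ℤ) = l + m + n by ring]
      have h := (strictSum₃_invPow_of_odd_weight hodd'' hp2 (not_prime_sub_one_dvd hn (by omega))
        (not_prime_sub_one_dvd hl (by omega))).1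
      -- Reflection gives `H(l,m,n) = -H(n,m,l)`, and the antipode turns `H(n,m,l)` into `S(l,m,n)`.
      rw [strictSum₃_invPow_reverse, hodd'.neg_one_zpow, h, neg_one_mul]
      exact (multHarmonicSumStar_three_reducesTo hp1 _ _ _).neg
    refine ⟨(H₃ _ _ _).ratModEq hS, hS.ratModEq ?_⟩
    have h := strictSum₃_reducesTo_oddTripleI_sub hp2 hl hm hn (by omega) (by omega) (by omega) hodd
    rw [oddTripleI_of_lt hw, oddTripleI_of_lt (by omega),
      show n + m + l = l + m + n by ring] at h
    convert h using 1
    ring
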